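/- Let $\mathcal A$ be an abelian category and let $\mathcal X,\mathcal Y$ be classes of objects of $\mathcal A$; $\mathrm{Proj}(\mathcal A)$ is the class of projective objects. Notation. All dimensions lie in $\mathbb N\cup\{\infty\}$, with $\min\emptyset=\infty$. For a class $\mathcal Z$ put $\mathrm{pd}_{\mathcal Z}(M)=\min\{n\in\mathbb N: \mathrm{Ext}^j_{\mathcal A}(M,Z)=0\ \forall j>n,\ \forall Z\in\mathcal Z\}$, and let $\mathrm{resdim}_{\mathcal Z}(M)$ be the least $n\in\mathbb N$ for which there is an exact sequence $0\to Z_n\to\cdots\to Z_0\to M\to 0$ with all $Z_i\in\mathcal Z$. $\mathcal Z^\wedge$ is the class of all $M$ with $\mathrm{resdim}_{\mathcal Z}(M)<\infty$. The dimension of a class is the supremum of the dimensions of its objects, and $\mathrm{pd}=\mathrm{pd}_{\mathcal A}$. Moreover ${}^\perp\mathcal Y=\{M:\mathrm{Ext}^j_{\mathcal A}(M,Y)=0\ \forall j>0,\ \forall Y\in\mathcal Y\}$. $\mathcal{GP}_{(\mathcal X,\mathcal Y)}$ is the class of objects $M\cong\mathrm{Im}(X_0\to X^0)$ for an acyclic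 complex $\eta:\cdots\to X_1\to X_0\to X^0\to X^1\to\cdots$ with all terms in $\mathcal X$ such that $\mathrm{Hom}_{\mathcal A}(\eta,Y)$ is acyclic for all $Y\in\mathcal Y$. $W\mathcal{GP}_{(\mathcal X,\mathcal Y)}$ is the class of objects $M\in{}^\perp\mathcal Y$ for which there is an exact sequence $0\to M\to X^0\to X^1\to\cdots$ with $X^i\in\mathcal X$ and $\mathrm{Im}(X^i\to X^{i+1})\in{}^\perp\mathcal Y$ for all $i\ge 0$. Put $$\mathrm{FGPD}_{(\mathcal X,\mathcal Y)}(\mathcal A)=\mathrm{resdim}_{\mathcal{GP}_{(\mathcal X,\mathcal Y)}}\bigl(\mathcal{GP}_{(\mathcal X,\mathcal Y)}^\wedge\bigr),\quad \mathrm{WFGPD}_{(\mathcal X,\mathcal Y)}(\mathcal A)=\mathrm{resdim}_{W\mathcal{GP}_{(\mathcal X,\mathcal Y)}}\bigl(W\mathcal{GP}_{(\mathcal X,\mathcal Y)}^\wedge\bigr),\quad \mathrm{FPD}(\mathcal A)=\mathrm{pd}\bigl(\mathrm{Proj}(\mathcal A)^\wedge\bigr).$$ The pair $(\mathcal X,\mathcal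 Y)$ is GP-admissible if $\mathrm{pd}_{\mathcal Y}(\mathcal X)=0$; every object of $\mathcal A$ is a quotient of an object of $\mathcal X$; $\mathcal X$ and $\mathcal Y$ are closed under finite coproducts and $\mathcal X$ is closed under extensions; and for every $X\in\mathcal X$ there is an exact sequence $0\to X\to W\to X'\to 0$ with $W\in\mathcal X\cap\mathcal Y$ and $X'\in\mathcal X$. A class is left thick if it is closed under extensions, kernels of epimorphisms between its objects, and direct summands. Theorem. Let $(\mathcal X,\mathcal Y)$ be GP-admissible in $\mathcal A$ with $\omega:=\mathcal X\cap\mathcal Y=\mathrm{Proj}(\mathcal A)$. (1) If $\mathcal X$ is left thick and $\mathcal X\subseteq\mathrm{Proj}(\mathcal A)^\wedge$, then (a) $\mathrm{FGPD}_{(\mathcal X,\mathcal Y)}(\mathcal A)=\mathrm{resdim}_{\mathcal X}(\mathcal X^\wedge)=\mathrm{resdim}_{\mathcal X}(\mathrm{Proj}(\mathcal A)^\wedge)=\mathrm{FPD}(\mathcal A)$; (b) if $\mathcal A$ has enough projectives, then $\mathrm{FGPD}_{(\mathrm{Proj}(\mathcal A),\mathcal Y)}(\mathcal A)=\mathrm{FGPD}_{(\mathcal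 X,\mathcal Y)}(\mathcal A)$. (2) Without the additional hypotheses of (1), $$\mathrm{FGPD}_{(\mathcal X,\mathcal Y)}(\mathcal A)=\mathrm{FPD}(\mathcal A)=\mathrm{WFGPD}_{(\omega,\mathcal Y)}(\mathcal A)=\mathrm{pd}_\omega(\omega^\wedge)=\mathrm{pd}_{\omega^\wedge}(\omega^\wedge).$$ -/

import Mathlib

open CategoryTheory CategoryTheory.Limits

universe v u

/-! Classes of objects of an abelian category are objects of type `ObjectProperty C`;
`X ⊓ Y` is the intersection, `X ≤ Y` the inclusion and `isProjective C` the class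
of all projective objects. Dimensions take values in `ℕ∞`, with `min ∅ = ⊤` (infinity). -/

namespace RelGor

section

variable {C : Type u} [Category.{v} C] [Abelian C]

/-- `Ext^j(M, N) = 0`, where `Ext` is Mathlib's `Ext` in an arbitrary abelian category
(computed in the universe `max u v`, in which the `Ext`-groups always exist). -/
def ExtVanishes (M N : C) (j : ℕ) : Prop :=
  letI := HasExt.standard C
  Subsingleton (Abelian.Ext.{max u v} M N j)

/-- The class `⊥Y` of the objects `M` with `Ext^j(M, N) = 0` for all `j > 0` and `N ∈ Y`. -/
def leftPerp (Y : ObjectProperty C) : ObjectProperty C :=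
  fun M => ∀ j : ℕ, 0 < j → ∀ N : C, Y N → ExtVanishes M N j

/-- Relative projective dimension `pd_X(M) = min {n | Ext^j(M, -)|_X = 0 for all j > n}`. -/
noncomputable def relPd (X : ObjectProperty C) (M : C) : ℕ∞ :=
  ⨅ (n : ℕ) (_ : ∀ j : ℕ, n < j → ∀ N : C, X N → ExtVanishes M N j), (n : ℕ∞)

/-- `pd_X(Z)`, the supremum of `pd_X(M)` over `M ∈ Z`. -/
noncomputable def relPdClass (X Z : ObjectProperty C) : ℕ∞ :=
  ⨆ (M : C) (_ : Z M), relPd X M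

/-- `pd(Z)`: the absolute projective dimension of a class, i.e. `pd_X(Z)` for `X` the class of all
objects. -/
noncomputable def pdClass (Z : ObjectProperty C) : ℕ∞ := relPdClass ⊤ Z

/-- `HasRes X n M`: there is an exact sequence `0 ⟶ X_n ⟶ ⋯ ⟶ X_1 ⟶ X_0 ⟶ M ⟶ 0` with all
`X_i ∈ X`. For `n = 0` this is an isomorphism `X_0 ≅ M`; a sequence of length `n + 1` is the
splice of a short exact sequence `0 ⟶ K ⟶ X_0 ⟶ M ⟶ 0` and such a sequence of length `n` ending
in `K`. -/
def HasRes (X : ObjectProperty C) : ℕ → C → Prop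
  | 0, M => ∃ X₀ : C, X X₀ ∧ Nonempty (X₀ ≅ M)
  | n + 1, M => ∃ (K X₀ : C) (f : K ⟶ X₀) (g : X₀ ⟶ M) (w : f ≫ g = 0),
      (ShortComplex.mk f g w).ShortExact ∧ X X₀ ∧ HasRes X n K

/-- The class `X^∧` of the objects that have a finite `X`-resolution. -/
def finRes (X : ObjectProperty C) : ObjectProperty C :=
  fun M => ∃ n : ℕ, HasRes X n M

/-- The `X`-resolution dimension of an object. -/
noncomputable def resdim (X : ObjectProperty C) (M : C) : ℕ∞ :=
  ⨅ (n : ℕ) (_ : HasRes X n M), (n : ℕ∞)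

/-- The `X`-resolution dimension of a class. -/
noncomputable def resdimClass (X Z : ObjectProperty C) : ℕ∞ :=
  ⨆ (M : C) (_ : Z M), resdim X M

/-- Left thick: closed under extensions, kernels of epimorphisms between objects of the class, and
direct summands. -/
structure LeftThick (X : ObjectProperty C) : Prop where
  extensions : X.IsClosedUnderExtensions
  kernels : ∀ ⦃A B : C⦄ (f : A ⟶ B) [Epi f], X A → X B → X (kernel f)
  summands : X.IsStableUnderRetracts

/-- `X` is `X`-epic in the category: every object is a quotient of an object of `X`. -/
def IsEpic (X : ObjectProperty C) : Prop :=
  ∀ A : C, ∃ (P : C) (p : P ⟶ A), X P ∧ Epi p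

/-- `W` is a relative cogenerator in `X`: `W ⊆ X`, and every `A ∈ X` is the kernel in a short
exact sequence `0 ⟶ A ⟶ B ⟶ A' ⟶ 0` with `B ∈ W` and `A' ∈ X`. -/
structure IsRelCogenerator (W X : ObjectProperty C) : Prop where
  le : W ≤ X
  exists_ses : ∀ A : C, X A → ∃ (B A' : C) (f : A ⟶ B) (g : B ⟶ A') (w : f ≫ g = 0),
    (ShortComplex.mk f g w).ShortExact ∧ W B ∧ X A'

/-- GP-admissible pairs. -/
structure GPAdmissible (X Y : ObjectProperty C) : Prop where
  relPd_eq_zero : relPdClass Y X = 0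
  epic : IsEpic X
  coproducts_left : X.IsClosedUnderFiniteCoproducts
  coproducts_right : Y.IsClosedUnderFiniteCoproducts
  extensions : X.IsClosedUnderExtensions
  cogenerator : IsRelCogenerator (X ⊓ Y) X

/-- A left complete `(X, Y)`-resolution: an acyclic complex `⋯ ⟶ K⁻¹ ⟶ K⁰ ⟶ K¹ ⟶ ⋯` of objects
of `X` such that for `N ∈ Y` the complex `Hom(K, N)` is acyclic, i.e. every `f : Kⁿ ⟶ N` which
vanishes on composition with `Kⁿ⁻¹ ⟶ Kⁿ` factors through `Kⁿ ⟶ Kⁿ⁺¹`. -/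
structure IsLeftCompleteResolution (X Y : ObjectProperty C) (K : CochainComplex C ℤ) : Prop where
  mem : ∀ n : ℤ, X (K.X n)
  acyclic : K.Acyclic
  hom_acyclic : ∀ N : C, Y N → ∀ (n : ℤ) (f : K.X n ⟶ N), K.d (n - 1) n ≫ f = 0 →
    ∃ g : K.X (n + 1) ⟶ N, K.d n (n + 1) ≫ g = f

/-- The class of `(X, Y)`-Gorenstein projective objects: the images `Im(K⁻¹ ⟶ K⁰)` for the left
complete `(X, Y)`-resolutions `K`. -/
def GP (X Y : ObjectProperty C) : ObjectProperty C :=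
  fun M => ∃ K : CochainComplex C ℤ, IsLeftCompleteResolution X Y K ∧
    Nonempty (M ≅ image (K.d (-1) 0))

/-- The class of weak `(X, Y)`-Gorenstein projective objects: `M ∈ ⊥Y` for which there is an exact
sequence `0 ⟶ M ⟶ K⁰ ⟶ K¹ ⟶ ⋯` with `Kⁱ ∈ X` and `Im(Kⁱ ⟶ Kⁱ⁺¹) ∈ ⊥Y` for all `i`. -/
def WGP (X Y : ObjectProperty C) : ObjectProperty C :=
  fun M => leftPerp Y M ∧
    ∃ (K : CochainComplex C ℕ) (f : M ⟶ K.X 0) (w : f ≫ K.d 0 1 = 0),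
      Mono f ∧ (ShortComplex.mk f (K.d 0 1) w).Exact ∧ (∀ i : ℕ, K.ExactAt (i + 1)) ∧
      (∀ i : ℕ, X (K.X i)) ∧ ∀ i : ℕ, leftPerp Y (image (K.d i (i + 1)))

/-- The finitistic `(X, Y)`-Gorenstein projective dimension `Gpd_{(X,Y)}(GP_{(X,Y)}^∧)`, where
`Gpd_{(X,Y)}` is the resolution dimension with respect to `GP_{(X,Y)}`. -/
noncomputable def FGPD (X Y : ObjectProperty C) : ℕ∞ :=
  resdimClass (GP X Y) (finRes (GP X Y))

/-- The weak finitistic `(X, Y)`-Gorenstein projective dimension. -/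
noncomputable def WFGPD (X Y : ObjectProperty C) : ℕ∞ :=
  resdimClass (WGP X Y) (finRes (WGP X Y))

variable (C) in
/-- The finitistic projective dimension `pd(Proj^∧)` of the category. -/
noncomputable def FPD : ℕ∞ := pdClass (finRes (isProjective C))

end

end RelGor

/-! All the Gorenstein classes involved are one coinductively defined class. Put G = `PerpCoresolved
ω Y` with ω = `X ⊓ Y`: the objects of ⊥Y that embed into ω with cokernel again in G, and so on
forever. Weak Gorenstein objects for ω form G by splicing (`WGP_eq_perpCoresolved`). `GP X Y` is G
too: epicness of X supplies the left half of a complete resolution, and the relative cogenerator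
replaces coresolutions by X with coresolutions by ω (`GP_eq_perpCoresolved_inf`). If ω = Proj, an
Auslander–Buchweitz argument (`resdimClass_finRes_eq`) compares resolution dimensions. An object
with a G-resolution of length n embeds, with cokernel in G, into one with a projective resolution of
length n, and shorter resolutions of the latter pull back. Conversely, on Proj^∧ extensions by
projectives already detect projective dimension, and G lies in ⊥Proj. The same detection identifies
pd, pd_ω and pd_{ω^∧}. In (1), objects of X have finite projective dimension and lie in ⊥Proj, so X
= Proj. -/

namespace RelGor

/-! ### Constructions with short exact sequences -/

section ShortExactSequences

variable {C : Type u} [Category.{v} C] [Abelian C]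

/-- There is a short exact sequence `0 ⟶ A ⟶ B ⟶ D ⟶ 0`. -/
def SES (A B D : C) : Prop :=
  ∃ (f : A ⟶ B) (g : B ⟶ D) (w : f ≫ g = 0), (ShortComplex.mk f g w).ShortExact

lemma SES.of_shortExact {S : ShortComplex C} (hS : S.ShortExact) : SES S.X₁ S.X₂ S.X₃ :=
  ⟨S.f, S.g, S.zero, hS⟩

lemma SES.of_iso {A A' B B' D D' : C} (h : SES A B D) (a : A ≅ A') (b : B ≅ B') (d : D ≅ D') :
    SES A' B' D' := by
  obtain ⟨f, g, w, h⟩ := h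
  refine ⟨a.inv ≫ f ≫ b.hom, b.inv ≫ g ≫ d.hom, by simp [reassoc_of% w], ?_⟩
  exact ShortComplex.shortExact_of_iso (ShortComplex.isoMk a b d) h

lemma SES.of_iso_left {A A' B D : C} (h : SES A B D) (a : A ≅ A') : SES A' B D :=
  h.of_iso a (Iso.refl _) (Iso.refl _)

lemma SES.of_iso_middle {A B B' D : C} (h : SES A B D) (b : B ≅ B') : SES A B' D :=
  h.of_iso (Iso.refl _) b (Iso.refl _)

lemma SES.op {A B D : C} (h : SES A B D) :
    SES (Opposite.op D) (Opposite.op B) (Opposite.op A) := by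
  obtain ⟨f, g, w, h⟩ := h
  exact SES.of_shortExact h.op

lemma SES.unop {A B D : Cᵒᵖ} (h : SES A B D) : SES D.unop B.unop A.unop := by
  obtain ⟨f, g, w, h⟩ := h
  exact SES.of_shortExact h.unop

/-- The pushout of a short exact sequence is a short exact sequence. -/
lemma shortExact_pushout {A B D A' : C} {f : A ⟶ B} {g : B ⟶ D} {w : f ≫ g = 0}
    (h : (ShortComplex.mk f g w).ShortExact) (a : A ⟶ A') :
    (ShortComplex.mk (pushout.inr f a) (pushout.desc g 0 (by rw [w, comp_zero]))
      (pushout.inr_desc _ _ _)).ShortExact := by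
  have : Mono f := h.mono_f
  have : Epi g := h.epi_g
  have hepi : Epi (pushout.desc g (0 : A' ⟶ D) (by rw [w, comp_zero] : f ≫ g = a ≫ 0)) :=
    epi_of_epi_fac (pushout.inl_desc g 0 _)
  refine ShortComplex.ShortExact.mk' ?_ inferInstance hepi
  apply ShortComplex.exact_of_g_is_cokernel
  refine CokernelCofork.IsColimit.ofπ' _ _ (fun {Z} k hk => ?_)
  dsimp at k hk
  have hk' : f ≫ pushout.inl f a ≫ k = 0 := by rw [pushout.condition_assoc, hk, comp_zero]
  refine ⟨h.exact.desc (pushout.inl f a ≫ k) hk', ?_⟩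
  apply pushout.hom_ext
  · exact (pushout.inl_desc_assoc _ _ _ _).trans (h.exact.g_desc _ _)
  · exact (pushout.inr_desc_assoc _ _ _ _).trans (zero_comp.trans hk.symm)

/-- If `f : A ⟶ B` is the kernel of the epimorphism `g : B ⟶ D` and `i : B ⟶ W` is a
monomorphism, then `f ≫ i` is the kernel of the pushout of `g` along `i`. -/
lemma shortExact_pushout_inl {A B D W : C} {f : A ⟶ B} {g : B ⟶ D} {w : f ≫ g = 0}
    (h : (ShortComplex.mk f g w).ShortExact) (i : B ⟶ W) [Mono i] :
    (ShortComplex.mk (f ≫ i) (pushout.inl i g)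
      (by rw [Category.assoc, pushout.condition, reassoc_of% w, zero_comp])).ShortExact := by
  have : Mono f := h.mono_f
  have : Epi g := h.epi_g
  refine ShortComplex.ShortExact.mk' ?_ (mono_comp _ _) inferInstance
  rw [ShortComplex.exact_iff_exact_up_to_refinements]
  intro T k hk
  dsimp at k hk
  obtain ⟨T', π, hπ, b, hb⟩ := (IsPushout.of_hasPushout i g).exact_shortComplex
    |>.exact_up_to_refinements (biprod.lift k 0) (by
      change biprod.lift k 0 ≫ biprod.desc (pushout.inl i g) (pushout.inr i g) = 0
      simp [biprod.lift_desc, hk])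
  change T' ⟶ B at b
  change π ≫ biprod.lift k 0 = b ≫ biprod.lift i (-g) at hb
  have hb₁ : π ≫ k = b ≫ i := by simpa using hb =≫ biprod.fst
  have hb₂ : b ≫ g = 0 := by simpa using hb =≫ biprod.snd
  obtain ⟨T'', π', hπ', a, ha⟩ := h.exact.exact_up_to_refinements b hb₂
  refine ⟨T'', π' ≫ π, epi_comp _ _, a, ?_⟩
  dsimp at ha ⊢
  rw [Category.assoc, hb₁, reassoc_of% ha]

lemma SES.pushout {A B D A' D' : C} (h : SES A B D) (h' : SES A A' D') :
    ∃ F : C, SES A' F D ∧ SES B F D' := by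
  obtain ⟨f, g, w, h⟩ := h
  obtain ⟨f', g', w', h'⟩ := h'
  exact ⟨_, SES.of_shortExact (shortExact_pushout h f'),
    (SES.of_shortExact (shortExact_pushout h' f)).of_iso_middle (pushoutSymmetry _ _)⟩

/-- The third isomorphism theorem: for `A ⊆ B ⊆ W` there is a short exact sequence
`0 ⟶ B/A ⟶ W/A ⟶ W/B ⟶ 0`. -/
lemma SES.third_iso {A B D W E : C} (h : SES A B D) (h' : SES B W E) :
    ∃ Q : C, SES A W Q ∧ SES D Q E := by
  obtain ⟨f, g, w, h⟩ := h
  obtain ⟨i, p, w', h'⟩ := h'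
  have : Mono i := h'.mono_f
  exact ⟨_, SES.of_shortExact (shortExact_pushout_inl h i),
    SES.of_shortExact (shortExact_pushout h' g)⟩

/-- Dual of `SES.third_iso`: `F` is the preimage of `M ⊆ H` in `P`. -/
lemma SES.pullback {K P H M G : C} (h : SES K P H) (h' : SES M H G) :
    ∃ F : C, SES K F M ∧ SES F P G := by
  obtain ⟨Q, h₁, h₂⟩ := h'.op.third_iso h.op
  exact ⟨Q.unop, h₂.unop, h₁.unop⟩

/-- The splitting identifies `F` with `A ⊞ D`, and only the summand `D` has to be embedded into `W`.
-/
lemma SES.biprod_of_splitting {A F D W E : C} {f : A ⟶ F} {g : F ⟶ D} {w : f ≫ g = 0}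
    (s : (ShortComplex.mk f g w).Splitting) (h : SES D W E) : SES F (A ⊞ W) E := by
  obtain ⟨i, p, w', h⟩ := h
  have : Mono i := h.mono_f
  have : Epi p := h.epi_g
  have hf := s.f_r
  have hg := s.s_g
  have hid := s.id
  have hsr := s.s_r
  set r : F ⟶ A := s.r
  set σ : D ⟶ F := s.s
  dsimp at hf hg hid hsr
  refine ⟨biprod.lift r (g ≫ i), biprod.snd ≫ p, by simp [w'],
    ShortComplex.ShortExact.mk' ?_ ?_ (epi_comp _ _)⟩
  · rw [ShortComplex.exact_iff_exact_up_to_refinements]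
    intro T k hk
    dsimp at k hk
    refine ⟨T, 𝟙 _, inferInstance, (k ≫ biprod.fst) ≫ f +
      h.exact.lift (k ≫ biprod.snd) (by simpa using hk) ≫ σ, ?_⟩
    have hl := h.exact.lift_f (k ≫ biprod.snd) (by simpa using hk)
    dsimp at hl ⊢
    ext
    · simp [hf, hsr]
    · simp [reassoc_of% w, reassoc_of% hg, hl]
  · rw [Preadditive.mono_iff_cancel_zero]
    intro T k hk
    dsimp at k hk
    have h₁ : k ≫ r = 0 := by simpa using hk =≫ biprod.fst
    have h₂ : k ≫ g = 0 := by
      rw [← cancel_mono i]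
      simpa using hk =≫ biprod.snd
    rw [← Category.comp_id k, ← hid]
    simp [reassoc_of% h₁, reassoc_of% h₂]

end ShortExactSequences

/-! ### Vanishing of Ext along short exact sequences -/

section ExtVanishing

variable {C : Type u} [Category.{v} C] [Abelian C]

open Abelian

lemma extVanishes_iff [HasExt.{max u v} C] {M N : C} {j : ℕ} :
    ExtVanishes M N j ↔ ∀ e : Ext.{max u v} M N j, e = 0 :=
  ⟨fun h e => by
    have : Subsingleton (Ext.{max u v} M N j) := h
    exact Subsingleton.elim _ _, fun h => ⟨fun a b => by rw [h a, h b]⟩⟩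

lemma extVanishes_projective {P : C} (hP : Projective P) (N : C) {j : ℕ} (hj : 0 < j) :
    ExtVanishes P N j := by
  let := HasExt.standard C
  rw [extVanishes_iff]
  obtain ⟨j, rfl⟩ := Nat.exists_eq_succ_of_ne_zero hj.ne'
  exact fun e => e.eq_zero_of_projective

lemma SES.extVanishes_middle {A B D N : C} (h : SES A B D) {j : ℕ}
    (hA : ExtVanishes A N j) (hD : ExtVanishes D N j) : ExtVanishes B N j := by
  let := HasExt.standard C
  rw [extVanishes_iff] at *
  obtain ⟨f, g, w, h⟩ := h
  intro e
  obtain ⟨x, rfl⟩ := Ext.contravariant_sequence_exact₂ h N e (hA _)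
  rw [hD x, Ext.comp_zero]

lemma SES.extVanishes_left {A B D N : C} (h : SES A B D) {j : ℕ}
    (hB : ExtVanishes B N j) (hD : ExtVanishes D N (j + 1)) : ExtVanishes A N j := by
  let := HasExt.standard C
  rw [extVanishes_iff] at *
  obtain ⟨f, g, w, h⟩ := h
  intro e
  obtain ⟨x, rfl⟩ := Ext.contravariant_sequence_exact₁ h N e (add_comm 1 j) (hD _)
  rw [hB x, Ext.comp_zero]

lemma SES.extVanishes_right {A B D N : C} (h : SES A B D) {j : ℕ}
    (hA : ExtVanishes A N j) (hB : ExtVanishes B N (j + 1)) : ExtVanishes D N (j + 1) := by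
  let := HasExt.standard C
  rw [extVanishes_iff] at *
  obtain ⟨f, g, w, h⟩ := h
  intro e
  obtain ⟨x, rfl⟩ := Ext.contravariant_sequence_exact₃ h N e (hB _) (add_comm 1 j)
  rw [hA x, Ext.comp_zero]

lemma SES.extVanishes_of_target {M A B D : C} (h : SES A B D) {j : ℕ}
    (hB : ExtVanishes M B j) (hA : ExtVanishes M A (j + 1)) : ExtVanishes M D j := by
  let := HasExt.standard C
  rw [extVanishes_iff] at *
  obtain ⟨f, g, w, h⟩ := h
  intro e
  obtain ⟨x, rfl⟩ := Ext.covariant_sequence_exact₃ M h e rfl (hA _)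
  rw [hB x, Ext.zero_comp]

lemma ExtVanishes.of_iso {M M' N : C} {j : ℕ} (h : ExtVanishes M N j) (e : M ≅ M') :
    ExtVanishes M' N j := by
  let := HasExt.standard C
  rw [extVanishes_iff] at *
  intro x
  have := h ((Ext.mk₀ e.hom).comp x (zero_add _))
  rw [← Ext.mk₀_id_comp x, ← e.inv_hom_id, ← Ext.mk₀_comp_mk₀_assoc, this, Ext.comp_zero]

lemma ExtVanishes.of_iso_right {M N N' : C} {j : ℕ} (h : ExtVanishes M N j) (e : N ≅ N') :
    ExtVanishes M N' j := by
  let := HasExt.standard C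
  rw [extVanishes_iff] at *
  intro x
  have h₁ := h (x.comp (Ext.mk₀ e.inv) (add_zero _))
  rw [← Ext.comp_mk₀_id x, ← e.inv_hom_id, ← Ext.mk₀_comp_mk₀,
    ← Ext.comp_assoc_of_third_deg_zero, h₁, Ext.zero_comp]

lemma ExtVanishes.exists_extension {S : ShortComplex C} (hS : S.ShortExact) {N : C}
    (hN : ExtVanishes S.X₃ N 1) (k : S.X₁ ⟶ N) : ∃ l : S.X₂ ⟶ N, S.f ≫ l = k := by
  let := HasExt.standard C
  rw [extVanishes_iff] at hN
  obtain ⟨x, hx⟩ := Ext.contravariant_sequence_exact₁ hS N (Ext.mk₀ k) rfl (hN _)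
  obtain ⟨l, rfl⟩ := (Ext.mk₀_bijective _ _).2 x
  refine ⟨l, (Ext.mk₀_bijective _ _).1 ?_⟩
  rw [← hx, Ext.mk₀_comp_mk₀]

/-- Since Ext¹ of the middle term vanishes, every class is the connecting image of some `k : S.X₁ ⟶
N`; the connecting map kills those `k` that extend to `S.X₂`. -/
lemma extVanishes_one_of_extensions {S : ShortComplex C} (hS : S.ShortExact) {N : C}
    (hN : ExtVanishes S.X₂ N 1) (h : ∀ k : S.X₁ ⟶ N, ∃ l : S.X₂ ⟶ N, S.f ≫ l = k) :
    ExtVanishes S.X₃ N 1 := by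
  let := HasExt.standard C
  rw [extVanishes_iff] at *
  intro e
  obtain ⟨x, rfl⟩ := Ext.contravariant_sequence_exact₃ hS N e (hN _) (add_zero 1)
  obtain ⟨k, rfl⟩ := (Ext.mk₀_bijective _ _).2 x
  obtain ⟨l, rfl⟩ := h k
  rw [← Ext.mk₀_comp_mk₀, hS.extClass_comp_assoc]

/-- A short exact sequence `S` with `Ext¹(S.X₃, S.X₁) = 0` splits. -/
lemma nonempty_splitting_of_extVanishes {S : ShortComplex C} (hS : S.ShortExact)
    (h : ExtVanishes S.X₃ S.X₁ 1) : Nonempty S.Splitting := by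
  obtain ⟨r, hr⟩ := ExtVanishes.exists_extension hS h (𝟙 _)
  have := hS.epi_g
  exact ⟨ShortComplex.Splitting.ofExactOfRetraction S hS.exact r hr inferInstance⟩

lemma SES.projective_right {K P M : C} (h : SES K P M) (hP : Projective P)
    (hM : ExtVanishes M K 1) : Projective M := by
  obtain ⟨f, g, w, h⟩ := h
  obtain ⟨s⟩ := nonempty_splitting_of_extVanishes h hM
  exact Retract.projective ⟨s.s, g, s.s_g⟩

lemma SES.biprod_of_extVanishes {A F D W E : C} (h : SES A F D) (hD : ExtVanishes D A 1)
    (h' : SES D W E) : SES F (A ⊞ W) E := by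
  obtain ⟨f, g, w, h⟩ := h
  obtain ⟨s⟩ := nonempty_splitting_of_extVanishes h hD
  exact SES.biprod_of_splitting s h'

end ExtVanishing

/-! ### Resolution dimension and relative projective dimension -/

section Dimensions

lemma iInf_natCast_le_iff {p : ℕ → Prop} {n : ℕ} :
    (⨅ (k : ℕ) (_ : p k), (k : ℕ∞)) ≤ n ↔ ∃ k ≤ n, p k := by
  constructor
  · intro h
    by_contra! hn
    have : ((n + 1 : ℕ) : ℕ∞) ≤ ⨅ (k : ℕ) (_ : p k), (k : ℕ∞) := by
      refine le_iInf₂ fun k hk => ?_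
      by_contra hlt
      exact hn k (by have := ENat.natCast_lt_natCast.1 (not_le.1 hlt); omega) hk
    have := ENat.natCast_le_natCast.1 (this.trans h)
    omega
  · rintro ⟨k, hk, hp⟩
    exact (iInf₂_le k hp).trans (by exact_mod_cast hk)

lemma le_of_forall_natCast {a b : ℕ∞} (h : ∀ n : ℕ, b ≤ n → a ≤ n) : a ≤ b := by
  cases b with
  | top => exact le_top
  | coe b => exact h b le_rfl

variable {C : Type u} [Category.{v} C] [Abelian C]

lemma relPd_le_iff {Z : ObjectProperty C} {M : C} {n : ℕ} :
    relPd Z M ≤ n ↔ ∀ j : ℕ, n < j → ∀ N : C, Z N → ExtVanishes M N j := by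
  rw [relPd, iInf_natCast_le_iff]
  exact ⟨fun ⟨k, hk, h⟩ j hj => h j (hk.trans_lt hj), fun h => ⟨n, le_rfl, h⟩⟩

lemma resdim_le_iff {X : ObjectProperty C} {M : C} {n : ℕ} :
    resdim X M ≤ n ↔ ∃ k ≤ n, HasRes X k M :=
  iInf_natCast_le_iff

lemma hasRes_succ_iff {X : ObjectProperty C} {n : ℕ} {M : C} :
    HasRes X (n + 1) M ↔ ∃ K X₀ : C, SES K X₀ M ∧ X X₀ ∧ HasRes X n K :=
  ⟨fun ⟨K, X₀, f, g, w, h, h₀, hK⟩ => ⟨K, X₀, ⟨f, g, w, h⟩, h₀, hK⟩,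
    fun ⟨K, X₀, ⟨f, g, w, h⟩, h₀, hK⟩ => ⟨K, X₀, f, g, w, h, h₀, hK⟩⟩

lemma HasRes.mono {X X' : ObjectProperty C} (hX : X ≤ X') {n : ℕ} {M : C} (h : HasRes X n M) :
    HasRes X' n M := by
  induction n generalizing M with
  | zero =>
    obtain ⟨X₀, h₀, e⟩ := h
    exact ⟨X₀, hX _ h₀, e⟩
  | succ n ih =>
    rw [hasRes_succ_iff] at h ⊢
    obtain ⟨K, X₀, h, h₀, hK⟩ := h
    exact ⟨K, X₀, h, hX _ h₀, ih hK⟩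

lemma finRes_mono {X X' : ObjectProperty C} (hX : X ≤ X') : finRes X ≤ finRes X' :=
  fun _ ⟨n, h⟩ => ⟨n, h.mono hX⟩

lemma le_finRes (X : ObjectProperty C) : X ≤ finRes X :=
  fun M h => ⟨0, M, h, ⟨Iso.refl M⟩⟩

/-- An object with an `X`-resolution of length `n` has no extensions of degree `> n` by `N`,
if the objects of `X` have no extensions of positive degree by `N`. -/
lemma HasRes.extVanishes {X : ObjectProperty C} {N : C}
    (hX : ∀ A : C, X A → ∀ j : ℕ, 0 < j → ExtVanishes A N j) {n : ℕ} {M : C}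
    (h : HasRes X n M) {j : ℕ} (hj : n < j) : ExtVanishes M N j := by
  induction n generalizing M j with
  | zero =>
    obtain ⟨X₀, h₀, ⟨e⟩⟩ := h
    exact (hX X₀ h₀ j hj).of_iso e
  | succ n ih =>
    rw [hasRes_succ_iff] at h
    obtain ⟨K, X₀, h, h₀, hK⟩ := h
    obtain ⟨j, rfl⟩ := Nat.exists_eq_succ_of_ne_zero (by omega : j ≠ 0)
    exact h.extVanishes_right (ih hK (by omega)) (hX X₀ h₀ _ (by omega))

/-- Dimension shifting in the second variable raises the degree, so the bound `n` does not depend on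
the length `m`. -/
lemma HasRes.extVanishes_of_target {X : ObjectProperty C} {M : C} {n : ℕ}
    (hM : ∀ j : ℕ, n < j → ∀ N : C, X N → ExtVanishes M N j) {m : ℕ} {Z : C}
    (h : HasRes X m Z) {j : ℕ} (hj : n < j) : ExtVanishes M Z j := by
  induction m generalizing Z j with
  | zero =>
    obtain ⟨X₀, h₀, ⟨e⟩⟩ := h
    exact (hM j hj X₀ h₀).of_iso_right e
  | succ m ih =>
    rw [hasRes_succ_iff] at h
    obtain ⟨K, X₀, h, h₀, hK⟩ := h
    exact h.extVanishes_of_target (hM j hj X₀ h₀) (ih hK (by omega))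

/-- The first syzygy has a finite projective resolution, so Ext¹ of `M` by it vanishes and the
projective cover sequence `0 ⟶ K ⟶ P ⟶ M ⟶ 0` splits. -/
lemma projective_of_hasRes {m : ℕ} {M : C} (h : HasRes (isProjective C) m M)
    (hM : ∀ j : ℕ, 0 < j → ∀ N : C, isProjective C N → ExtVanishes M N j) : Projective M := by
  cases m with
  | zero =>
    obtain ⟨P, hP, ⟨e⟩⟩ := h
    exact Projective.of_iso e hP
  | succ m =>
    rw [hasRes_succ_iff] at h
    obtain ⟨K, P, h, hP, hK⟩ := h
    exact h.projective_right hP (hK.extVanishes_of_target hM one_pos)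

/-- For an object of finite projective dimension, the dimension is detected by extensions by
projective objects. -/
lemma exists_hasRes_of_extVanishes {m n : ℕ} {M : C} (h : HasRes (isProjective C) m M)
    (hM : ∀ j : ℕ, n < j → ∀ N : C, isProjective C N → ExtVanishes M N j) :
    ∃ k ≤ n, HasRes (isProjective C) k M := by
  induction n generalizing m M with
  | zero => exact ⟨0, le_rfl, M, projective_of_hasRes h hM, ⟨Iso.refl M⟩⟩
  | succ n ih =>
    cases m with
    | zero => exact ⟨0, by omega, h⟩
    | succ m =>
      rw [hasRes_succ_iff] at h
      obtain ⟨K, P, h, hP, hK⟩ := h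
      -- Passing to the syzygy lowers the degree of vanishing by one.
      obtain ⟨k, hk, hKk⟩ := ih hK fun j hj N hN =>
        h.extVanishes_left (extVanishes_projective hP N (by omega)) (hM (j + 1) (by omega) N hN)
      exact ⟨k + 1, by omega, hasRes_succ_iff.2 ⟨K, P, h, hP, hKk⟩⟩

/-- The right side does not involve `Z`; this is why testing against ω, ω^∧ or all objects gives the
same dimension. -/
lemma relPd_eq_resdim {Z : ObjectProperty C} (hZ : isProjective C ≤ Z) {M : C}
    (hM : finRes (isProjective C) M) : relPd Z M = resdim (isProjective C) M := by
  obtain ⟨m, hm⟩ := hM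
  apply le_antisymm
  · refine le_of_forall_natCast fun n hn => ?_
    obtain ⟨k, hk, h⟩ := resdim_le_iff.1 hn
    exact relPd_le_iff.2 fun j hj N _ =>
      h.extVanishes (fun P hP i hi => extVanishes_projective hP N hi) (by omega)
  · refine le_of_forall_natCast fun n hn => resdim_le_iff.2 ?_
    exact exists_hasRes_of_extVanishes hm fun j hj N hN => relPd_le_iff.1 hn j hj N (hZ _ hN)

lemma relPdClass_finRes_isProjective {Z : ObjectProperty C} (hZ : isProjective C ≤ Z) :
    relPdClass Z (finRes (isProjective C)) =
      resdimClass (isProjective C) (finRes (isProjective C)) :=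
  iSup_congr fun _ => iSup_congr fun hM => relPd_eq_resdim hZ hM

lemma FPD_eq_resdimClass : FPD C = resdimClass (isProjective C) (finRes (isProjective C)) :=
  relPdClass_finRes_isProjective le_top

/-! ### Auslander–Buchweitz approximation -/

/-- If `W` cogenerates the extension closed class `G`, then an object with a `G`-resolution of
length `n` embeds into an object with a `W`-resolution of length `n`, with cokernel in `G`. -/
lemma HasRes.exists_ses {G W : ObjectProperty C}
    (hext : ∀ {A B D : C}, SES A B D → G A → G D → G B)
    (hcog : ∀ A : C, G A → ∃ B A' : C, SES A B A' ∧ W B ∧ G A') {n : ℕ} {M : C}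
    (h : HasRes G n M) : ∃ H G' : C, SES M H G' ∧ HasRes W n H ∧ G G' := by
  induction n generalizing M with
  | zero =>
    obtain ⟨A, hA, ⟨e⟩⟩ := h
    obtain ⟨B, A', h, hB, hA'⟩ := hcog A hA
    exact ⟨B, A', h.of_iso_left e, ⟨B, hB, ⟨Iso.refl B⟩⟩, hA'⟩
  | succ n ih =>
    rw [hasRes_succ_iff] at h
    obtain ⟨K, A, h, hA, hK⟩ := h
    obtain ⟨H, G', hH, hHn, hG'⟩ := ih hK
    -- `F` is an extension of `G'` by `A`, hence in `G`, and `F/H = M`. For `H ⊆ F ⊆ B` with `B` in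
    -- `W`, the quotient `Q = B/H` contains `M` with cokernel `B/F`.
    obtain ⟨F, h₁, h₂⟩ := h.pushout hH
    obtain ⟨B, F', h₃, hB, hF'⟩ := hcog F (hext h₂ hA hG')
    obtain ⟨Q, h₄, h₅⟩ := h₁.third_iso h₃
    exact ⟨Q, F', h₅, hasRes_succ_iff.2 ⟨H, B, h₄, hB, hHn⟩, hF'⟩

/-- Pulling back the first cover `B ⟶ H` along `M ⟶ H` keeps the syzygy `K` and replaces `B` by the
kernel of `B ⟶ G'`, which lies in `G`. -/
lemma HasRes.of_ses {G W : ObjectProperty C} (hWG : W ≤ G)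
    (hker : ∀ {A B D : C}, SES A B D → W B → G D → G A) {n : ℕ} {M H G' : C}
    (h : SES M H G') (hH : HasRes W n H) (hG' : G G') : HasRes G n M := by
  cases n with
  | zero =>
    obtain ⟨B, hB, ⟨e⟩⟩ := hH
    exact ⟨M, hker (h.of_iso_middle e.symm) hB hG', ⟨Iso.refl M⟩⟩
  | succ n =>
    rw [hasRes_succ_iff] at hH ⊢
    obtain ⟨K, B, hK, hB, hKn⟩ := hH
    obtain ⟨F, h₁, h₂⟩ := hK.pullback h
    exact ⟨K, F, h₁, hker h₂ hB hG', hKn.mono hWG⟩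

lemma resdimClass_finRes_eq {G : ObjectProperty C} (hG : G ≤ leftPerp (isProjective C))
    (hPG : isProjective C ≤ G)
    (hext : ∀ {A B D : C}, SES A B D → G A → G D → G B)
    (hcog : ∀ A : C, G A → ∃ B A' : C, SES A B A' ∧ isProjective C B ∧ G A')
    (hker : ∀ {A B D : C}, SES A B D → isProjective C B → G D → G A) :
    resdimClass G (finRes G) = resdimClass (isProjective C) (finRes (isProjective C)) := by
  apply le_antisymm
  · refine iSup₂_le fun M ⟨m, hm⟩ => ?_
    obtain ⟨H, G', h, hH, hG'⟩ := hm.exists_ses hext hcog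
    -- The length `m` only shows that `H` belongs to Proj^∧; the bound for `M` comes from an
    -- arbitrary shorter resolution of `H`.
    refine le_trans (le_of_forall_natCast fun n hn => ?_) (le_iSup₂ H ⟨m, hH⟩)
    obtain ⟨k, hk, hHk⟩ := resdim_le_iff.1 hn
    exact resdim_le_iff.2 ⟨k, hk, HasRes.of_ses hPG hker h hHk hG'⟩
  · refine iSup₂_le fun M hM => ?_
    refine le_trans (le_of_forall_natCast fun n hn => ?_) (le_iSup₂ M (finRes_mono hPG M hM))
    obtain ⟨k, hk, hMk⟩ := resdim_le_iff.1 hn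
    obtain ⟨m, hm⟩ := hM
    exact resdim_le_iff.2 (exists_hasRes_of_extVanishes hm fun j hj N hN =>
      hMk.extVanishes (fun A hA i hi => hG A hA i hi N hN) (by omega))

end Dimensions

/-! ### The coinductive class of coresolved objects -/

section PerpCoresolved

variable {C : Type u} [Category.{v} C] [Abelian C]

lemma leftPerp_left {Y : ObjectProperty C} {A B D : C} (h : SES A B D) (hB : leftPerp Y B)
    (hD : leftPerp Y D) : leftPerp Y A :=
  fun j hj N hN => h.extVanishes_left (hB j hj N hN) (hD (j + 1) (by omega) N hN)

lemma leftPerp_middle {Y : ObjectProperty C} {A B D : C} (h : SES A B D) (hA : leftPerp Y A)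
    (hD : leftPerp Y D) : leftPerp Y B :=
  fun j hj N hN => h.extVanishes_middle (hA j hj N hN) (hD j hj N hN)

lemma leftPerp_of_iso {Y : ObjectProperty C} {A B : C} (hA : leftPerp Y A) (e : A ≅ B) :
    leftPerp Y B :=
  fun j hj N hN => (hA j hj N hN).of_iso e

lemma leftPerp_anti {Y Y' : ObjectProperty C} (h : Y ≤ Y') : leftPerp Y' ≤ leftPerp Y :=
  fun _ hM j hj N hN => hM j hj N (h N hN)

lemma isProjective_le_leftPerp (Y : ObjectProperty C) : isProjective C ≤ leftPerp Y :=
  fun _ hP _ hj N _ => extVanishes_projective hP N hj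

lemma le_leftPerp_of_relPdClass_eq_zero {X Y : ObjectProperty C} (h : relPdClass Y X = 0) :
    X ≤ leftPerp Y := by
  intro M hM
  have h' : relPd Y M ≤ ((0 : ℕ) : ℕ∞) :=
    (le_iSup₂ (f := fun (M : C) (_ : X M) => relPd Y M) M hM).trans h.le
  exact relPd_le_iff.1 h'

/-- The largest class `S ⊆ ⊥Y` all of whose objects `M` admit a short exact sequence
`0 ⟶ M ⟶ A ⟶ M' ⟶ 0` with `A ∈ X` and `M' ∈ S`. -/
def PerpCoresolved (X Y : ObjectProperty C) : ObjectProperty C :=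
  fun M => ∃ S : ObjectProperty C, S M ∧ S ≤ leftPerp Y ∧
    ∀ N : C, S N → ∃ A N' : C, SES N A N' ∧ X A ∧ S N'

variable {X Y : ObjectProperty C}

lemma le_perpCoresolved {S : ObjectProperty C} (hS : S ≤ leftPerp Y)
    (h : ∀ N : C, S N → ∃ A N' : C, SES N A N' ∧ X A ∧ S N') : S ≤ PerpCoresolved X Y :=
  fun _ hM => ⟨S, hM, hS, h⟩

lemma perpCoresolved_le_leftPerp : PerpCoresolved X Y ≤ leftPerp Y :=
  fun M ⟨_, hM, hS, _⟩ => hS M hM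

lemma PerpCoresolved.exists_ses {M : C} (h : PerpCoresolved X Y M) :
    ∃ A M' : C, SES M A M' ∧ X A ∧ PerpCoresolved X Y M' := by
  obtain ⟨S, hM, hS, hS'⟩ := h
  obtain ⟨A, M', h, hA, hM'⟩ := hS' M hM
  exact ⟨A, M', h, hA, S, hM', hS, hS'⟩

lemma PerpCoresolved.of_ses {M A N : C} (h : SES M A N) (hM : leftPerp Y M) (hA : X A)
    (hN : PerpCoresolved X Y N) : PerpCoresolved X Y M := by
  refine le_perpCoresolved (S := fun L => leftPerp Y L ∧ ∃ A N : C, SES L A N ∧ X A ∧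
    PerpCoresolved X Y N) (fun _ h => h.1) ?_ M ⟨hM, A, N, h, hA, hN⟩
  rintro L ⟨-, A, N, h, hA, hN⟩
  exact ⟨A, N, h, hA, perpCoresolved_le_leftPerp N hN, hN.exists_ses⟩

lemma PerpCoresolved.of_iso {M N : C} (hM : PerpCoresolved X Y M) (e : M ≅ N) :
    PerpCoresolved X Y N := by
  obtain ⟨A, M', h, hA, hM'⟩ := hM.exists_ses
  exact of_ses (h.of_iso_left e) (leftPerp_of_iso (perpCoresolved_le_leftPerp M hM) e) hA hM'

lemma perpCoresolved_mono {X' : ObjectProperty C} (h : X ≤ X') :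
    PerpCoresolved X Y ≤ PerpCoresolved X' Y := by
  rintro M ⟨S, hM, hS, hS'⟩
  refine ⟨S, hM, hS, fun N hN => ?_⟩
  obtain ⟨A, N', h₁, hA, hN'⟩ := hS' N hN
  exact ⟨A, N', h₁, h _ hA, hN'⟩

lemma IsRelCogenerator.exists_SES {W : ObjectProperty C} (h : IsRelCogenerator W X) {A : C}
    (hA : X A) : ∃ B A' : C, SES A B A' ∧ W B ∧ X A' := by
  obtain ⟨B, A', f, g, w, h, hB, hA'⟩ := h.exists_ses A hA
  exact ⟨B, A', ⟨f, g, w, h⟩, hB, hA'⟩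

lemma IsRelCogenerator.le_perpCoresolved {W : ObjectProperty C} (h : IsRelCogenerator W X)
    (hX : X ≤ leftPerp Y) : X ≤ PerpCoresolved W Y :=
  RelGor.le_perpCoresolved hX fun _ hA => h.exists_SES hA

/-- A coresolution by `X` can be replaced by a coresolution by a relative cogenerator of `X`. -/
lemma perpCoresolved_eq_of_isRelCogenerator {W : ObjectProperty C} (hW : IsRelCogenerator W X)
    (hX : X ≤ leftPerp Y) (hext : X.IsClosedUnderExtensions) :
    PerpCoresolved X Y = PerpCoresolved W Y := by
  apply le_antisymm _ (perpCoresolved_mono hW.le)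
  -- The invariant for coinduction is the class of extensions `E` of an object of `X` by a
  -- coresolved object. Pushing out along `M ⟶ X₀` embeds `E` into some `F` in `X`, then into `B` in
  -- `W`, and `B/E` is again such an extension.
  have key : ∀ {M E A : C}, SES M E A → PerpCoresolved X Y M → X A →
      ∃ B Q : C, SES E B Q ∧ W B ∧ ∃ M' A' : C, SES M' Q A' ∧ PerpCoresolved X Y M' ∧ X A' := by
    intro M E A h hM hA
    obtain ⟨X₀, M', h₁, hX₀, hM'⟩ := hM.exists_ses
    obtain ⟨F, h₂, h₃⟩ := h.pushout h₁
    have hF : X F := by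
      obtain ⟨f, g, w, h₂⟩ := h₂
      exact X.prop_X₂_of_shortExact h₂ hX₀ hA
    obtain ⟨B, A', h₄, hB, hA'⟩ := hW.exists_SES hF
    obtain ⟨Q, h₅, h₆⟩ := h₃.third_iso h₄
    exact ⟨B, Q, h₅, hB, M', A', h₆, hM', hA'⟩
  intro M hM
  obtain ⟨X₀, M', h₁, hX₀, hM'⟩ := hM.exists_ses
  obtain ⟨B, A', h₄, hB, hA'⟩ := hW.exists_SES hX₀
  obtain ⟨Q, h₅, h₆⟩ := h₁.third_iso h₄
  refine PerpCoresolved.of_ses h₅ (perpCoresolved_le_leftPerp M hM) hB ?_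
  refine le_perpCoresolved (S := fun E => ∃ M A : C, SES M E A ∧ PerpCoresolved X Y M ∧ X A)
    ?_ ?_ Q ⟨M', A', h₆, hM', hA'⟩
  · rintro E ⟨M, A, h, hM, hA⟩
    exact leftPerp_middle h (perpCoresolved_le_leftPerp M hM) (hX A hA)
  · rintro E ⟨M, A, h, hM, hA⟩
    exact key h hM hA

/-- Horseshoe argument. The pushout `F` is an extension of `D` by `W₁`, which splits because `D` is
in ⊥Y and `W₁` in `Y`; so `B` embeds into `W₁ ⊞ W₂`. This is where coresolving terms in `Y` are
needed. -/
lemma PerpCoresolved.of_extension {W : ObjectProperty C} (hWY : W ≤ Y)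
    (hsum : ∀ {A B : C}, W A → W B → W (A ⊞ B)) {A B D : C} (h : SES A B D)
    (hA : PerpCoresolved W Y A) (hD : PerpCoresolved W Y D) : PerpCoresolved W Y B := by
  refine le_perpCoresolved (S := fun B => ∃ A D : C, SES A B D ∧ PerpCoresolved W Y A ∧
    PerpCoresolved W Y D) ?_ ?_ B ⟨A, D, h, hA, hD⟩
  · rintro B ⟨A, D, h, hA, hD⟩
    exact leftPerp_middle h (perpCoresolved_le_leftPerp A hA) (perpCoresolved_le_leftPerp D hD)
  · rintro B ⟨A, D, h, hA, hD⟩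
    obtain ⟨W₁, A₁, h₁, hW₁, hA₁⟩ := hA.exists_ses
    obtain ⟨W₂, D₁, h₂, hW₂, hD₁⟩ := hD.exists_ses
    obtain ⟨F, h₃, h₄⟩ := h.pushout h₁
    have h₅ := h₃.biprod_of_extVanishes
      (perpCoresolved_le_leftPerp D hD 1 one_pos W₁ (hWY _ hW₁)) h₂
    obtain ⟨Q, h₆, h₇⟩ := h₄.third_iso h₅
    exact ⟨_, Q, h₆, hsum hW₁ hW₂, A₁, D₁, h₇, hA₁, hD₁⟩

end PerpCoresolved

/-! ### Cutting complexes into short exact sequences and splicing them -/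

section Complexes

variable {C : Type u} [Category.{v} C] [Abelian C]

lemma exact_comp_iff {A M B N D : C} (e : A ⟶ M) [Epi e] (m : M ⟶ B) (p : B ⟶ N) (i : N ⟶ D)
    [Mono i] (w : m ≫ p = 0) (w' : (e ≫ m) ≫ p ≫ i = 0) :
    (ShortComplex.mk (e ≫ m) (p ≫ i) w').Exact ↔ (ShortComplex.mk m p w).Exact := by
  have w₁ : m ≫ p ≫ i = 0 := by rw [reassoc_of% w, zero_comp]
  let φ : ShortComplex.mk (e ≫ m) (p ≫ i) w' ⟶ ShortComplex.mk m (p ≫ i) w₁ :=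
    { τ₁ := e, τ₂ := 𝟙 _, τ₃ := 𝟙 _ }
  let ψ : ShortComplex.mk m p w ⟶ ShortComplex.mk m (p ≫ i) w₁ :=
    { τ₁ := 𝟙 _, τ₂ := 𝟙 _, τ₃ := i }
  have : Epi φ.τ₁ := inferInstanceAs (Epi e)
  have : IsIso φ.τ₂ := inferInstanceAs (IsIso (𝟙 B))
  have : Mono φ.τ₃ := inferInstanceAs (Mono (𝟙 D))
  have : Epi ψ.τ₁ := inferInstanceAs (Epi (𝟙 M))
  have : IsIso ψ.τ₂ := inferInstanceAs (IsIso (𝟙 B))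
  have : Mono ψ.τ₃ := inferInstanceAs (Mono i)
  exact (ShortComplex.exact_iff_of_epi_of_isIso_of_mono φ).trans
    (ShortComplex.exact_iff_of_epi_of_isIso_of_mono ψ).symm

lemma image_ι_factorThruImage {A B D : C} {a : A ⟶ B} {b : B ⟶ D} (w : a ≫ b = 0) :
    image.ι a ≫ factorThruImage b = 0 := by
  rw [← cancel_epi (factorThruImage a), ← cancel_mono (image.ι b)]
  simpa using w

lemma shortExact_image {A B D : C} {a : A ⟶ B} {b : B ⟶ D} {w : a ≫ b = 0}
    (h : (ShortComplex.mk a b w).Exact) :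
    (ShortComplex.mk (image.ι a) (factorThruImage b) (image_ι_factorThruImage w)).ShortExact := by
  refine ShortComplex.ShortExact.mk' ?_ inferInstance inferInstance
  rw [← exact_comp_iff (factorThruImage a) _ _ (image.ι b) _ (by simpa using w)]
  simpa using h

lemma SES.of_mono_of_exact {A B D : C} {a : A ⟶ B} {b : B ⟶ D} {w : a ≫ b = 0} [Mono a]
    (h : (ShortComplex.mk a b w).Exact) : SES A B (image b) :=
  (SES.of_shortExact (shortExact_image h)).of_iso_left (imageMonoIsoSource a)

lemma cochainComplex_exactAt_iff {α : Type*} [AddRightCancelSemigroup α] [One α]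
    {K : CochainComplex C α} {a b c : α} (hab : a + 1 = b) (hbc : b + 1 = c) :
    K.ExactAt b ↔ (ShortComplex.mk (K.d a b) (K.d b c) (K.d_comp_d a b c)).Exact :=
  K.exactAt_iff' a b c ((ComplexShape.up α).prev_eq' hab) ((ComplexShape.up α).next_eq' hbc)

section Splice

variable {α : Type*} [AddRightCancelSemigroup α] [One α]
  {M A : α → C} (f : ∀ n, M n ⟶ A n) (g : ∀ n, A n ⟶ M (n + 1)) (w : ∀ n, f n ≫ g n = 0)

/-- `k` descends to `M (n + 1 + 1)`, and then extends along `f (n + 1 + 1)`, whose cokernel is `M (n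
+ 1 + 1 + 1)`. -/
lemma exists_factorization_of_shortExact
    (h : ∀ n, (ShortComplex.mk (f n) (g n) (w n)).ShortExact) {N : C} {n : α} (k : A (n + 1) ⟶ N)
    (hk : (g n ≫ f (n + 1)) ≫ k = 0) (hN : ExtVanishes (M (n + 1 + 1 + 1)) N 1) :
    ∃ t : A (n + 1 + 1) ⟶ N, (g (n + 1) ≫ f (n + 1 + 1)) ≫ t = k := by
  have : Epi (g n) := (h n).epi_g
  have := (h (n + 1)).epi_g
  have hk' : f (n + 1) ≫ k = 0 := by
    rw [← cancel_epi (g n), comp_zero, ← Category.assoc, hk]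
  obtain ⟨t, ht⟩ := ExtVanishes.exists_extension (h (n + 1 + 1)) hN ((h (n + 1)).exact.desc k hk')
  refine ⟨t, ?_⟩
  rw [Category.assoc]
  exact (congrArg (g (n + 1) ≫ ·) ht).trans ((h (n + 1)).exact.g_desc k hk')

variable [DecidableEq α]

/-- The complex obtained by splicing short exact sequences `0 ⟶ M n ⟶ A n ⟶ M (n + 1) ⟶ 0`. -/
def splice : CochainComplex C α :=
  CochainComplex.of A (fun n => g n ≫ f (n + 1)) fun n => by
    rw [Category.assoc, reassoc_of% (w (n + 1)), zero_comp, comp_zero]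

lemma splice_d (n : α) : (splice f g w).d n (n + 1) = g n ≫ f (n + 1) :=
  CochainComplex.of_d A (fun n => g n ≫ f (n + 1)) n

variable (h : ∀ n, (ShortComplex.mk (f n) (g n) (w n)).ShortExact)

include h

lemma splice_exactAt (n : α) : (splice f g w).ExactAt (n + 1) := by
  have : Epi (g n) := (h n).epi_g
  have : Mono (f (n + 1 + 1)) := (h (n + 1 + 1)).mono_f
  rw [cochainComplex_exactAt_iff (a := n) rfl rfl]
  simp only [splice_d]
  exact (exact_comp_iff (g n) (f (n + 1)) (g (n + 1)) (f (n + 1 + 1)) (w _)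
    (by rw [Category.assoc, reassoc_of% (w (n + 1)), zero_comp, comp_zero])).2 (h (n + 1)).exact

lemma nonempty_splice_image_iso {k n : α} (hk : k + 1 = n) :
    Nonempty (M n ≅ image ((splice f g w).d k n)) := by
  subst hk
  have : Epi (g k) := (h k).epi_g
  have : Mono (f (k + 1)) := (h (k + 1)).mono_f
  have : StrongEpi (g k) := strongEpi_of_epi _
  have e : M (k + 1) ≅ image (g k ≫ f (k + 1)) := image.isoStrongEpiMono (g k) (f (k + 1)) rfl
  rw [splice_d]
  exact ⟨e⟩

end Splice

end Complexes

/-! ### Gorenstein projective classes as coresolved classes -/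

section GorensteinProjective

variable {C : Type u} [Category.{v} C] [Abelian C] {X Y : ObjectProperty C}

lemma WGP_le_perpCoresolved : WGP X Y ≤ PerpCoresolved X Y := by
  rintro M ⟨hM, K, f, w, hf, hex, hK, hX, hY⟩
  have hS : (fun N => ∃ i : ℕ, N = image (K.d i (i + 1))) ≤ PerpCoresolved X Y := by
    refine le_perpCoresolved ?_ ?_
    · rintro _ ⟨i, rfl⟩
      exact hY i
    · rintro _ ⟨i, rfl⟩
      exact ⟨K.X (i + 1), _, SES.of_shortExact (shortExact_image
        ((cochainComplex_exactAt_iff rfl rfl).1 (hK i))), hX _, i + 1, rfl⟩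
  exact PerpCoresolved.of_ses (SES.of_mono_of_exact hex) hM (hX 0) (hS _ ⟨0, rfl⟩)

lemma perpCoresolved_le_WGP : PerpCoresolved X Y ≤ WGP X Y := by
  intro M hM
  have next : ∀ N : Subtype (PerpCoresolved X Y), ∃ N' : Subtype (PerpCoresolved X Y),
      ∃ A : C, SES N.1 A N'.1 ∧ X A := fun N => by
    obtain ⟨A, N', h, hA, hN'⟩ := N.2.exists_ses
    exact ⟨⟨N', hN'⟩, A, h, hA⟩
  choose s hs using next
  -- The successive cosyzygies of `M`, starting with `M` itself.
  let Z : ℕ → Subtype (PerpCoresolved X Y) := fun n => n.rec ⟨M, hM⟩ fun _ N => s N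
  have hZ : ∀ n, ∃ (A : C) (f : (Z n).1 ⟶ A) (g : A ⟶ (Z (n + 1)).1) (w : f ≫ g = 0),
      (ShortComplex.mk f g w).ShortExact ∧ X A := fun n => by
    obtain ⟨A, ⟨f, g, w, h⟩, hA⟩ := hs (Z n)
    exact ⟨A, f, g, w, h, hA⟩
  choose A f g w h hA using hZ
  have hf : Mono (f 0) := (h 0).mono_f
  have hf₁ : Mono (f 1) := (h 1).mono_f
  have hd : (splice f g w).d 0 1 = g 0 ≫ f 1 := splice_d f g w 0
  refine ⟨perpCoresolved_le_leftPerp M hM, splice f g w, f 0, ?_, hf, ?_,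
    splice_exactAt f g w h, hA, fun i => ?_⟩
  · rw [hd]
    have w₀ : f 0 ≫ g 0 ≫ f 1 = 0 := by rw [reassoc_of% (w 0), zero_comp]
    exact w₀
  · simp only [hd]
    have w' : (𝟙 _ ≫ f 0) ≫ g 0 ≫ f 1 = 0 := by
      rw [Category.id_comp, reassoc_of% (w 0), zero_comp]
    have hex := (exact_comp_iff (𝟙 _) (f 0) (g 0) (f 1) (w 0) w').2 (h 0).exact
    simp only [Category.id_comp] at hex
    exact hex
  · obtain ⟨e⟩ := nonempty_splice_image_iso f g w h (k := i) rfl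
    exact leftPerp_of_iso (perpCoresolved_le_leftPerp _ (Z (i + 1)).2) e

lemma IsLeftCompleteResolution.exists_factorization {K : CochainComplex C ℤ}
    (hK : IsLeftCompleteResolution X Y K) {N : C} (hN : Y N) {a b c : ℤ} (hab : a + 1 = b)
    (hbc : b + 1 = c) (f : K.X b ⟶ N) (hf : K.d a b ≫ f = 0) :
    ∃ g : K.X c ⟶ N, K.d b c ≫ g = f := by
  obtain rfl : a = b - 1 := by omega
  subst hbc
  exact hK.hom_acyclic N hN b f hf

lemma IsLeftCompleteResolution.shortExact {K : CochainComplex C ℤ}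
    (hK : IsLeftCompleteResolution X Y K) {a b c : ℤ} (hab : a + 1 = b) (hbc : b + 1 = c) :
    (ShortComplex.mk (image.ι (K.d a b)) (factorThruImage (K.d b c))
      (image_ι_factorThruImage (K.d_comp_d _ _ _))).ShortExact :=
  shortExact_image ((cochainComplex_exactAt_iff hab hbc).1 (hK.acyclic b))

/-- Acyclicity of `Hom(K, N)` one place to the left says that every map from the image inside `K.X
b` to `N` extends to `K.X b`. -/
lemma IsLeftCompleteResolution.extVanishes_one {K : CochainComplex C ℤ}
    (hK : IsLeftCompleteResolution X Y K) (hX : X ≤ leftPerp Y) {N : C} (hN : Y N) {b c : ℤ}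
    (hbc : b + 1 = c) : ExtVanishes (image (K.d b c)) N 1 := by
  refine extVanishes_one_of_extensions (hK.shortExact (a := b - 1) (by omega) hbc)
    (hX _ (hK.mem b) 1 one_pos N hN) fun k => ?_
  dsimp at k ⊢
  obtain ⟨g, hg⟩ := hK.exists_factorization hN (a := b - 1 - 1) (b := b - 1) (c := b)
    (by omega) (by omega) (factorThruImage (K.d (b - 1) b) ≫ k) (by
      rw [← image.fac (K.d (b - 1 - 1) (b - 1)), Category.assoc,
        reassoc_of% (image_ι_factorThruImage (K.d_comp_d (b - 1 - 1) (b - 1) b)), zero_comp,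
        comp_zero])
  refine ⟨g, ?_⟩
  rw [← cancel_epi (factorThruImage (K.d (b - 1) b)), image.fac_assoc, hg]

lemma IsLeftCompleteResolution.leftPerp_image {K : CochainComplex C ℤ}
    (hK : IsLeftCompleteResolution X Y K) (hX : X ≤ leftPerp Y) {b c : ℤ} (hbc : b + 1 = c) :
    leftPerp Y (image (K.d b c)) := by
  intro j hj N hN
  induction j generalizing b c with
  | zero => omega
  | succ j ih =>
    rcases j.eq_zero_or_pos with rfl | hj'
    · exact hK.extVanishes_one hX hN hbc
    · exact (SES.of_shortExact (hK.shortExact (a := b - 1) (by omega) hbc)).extVanishes_right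
        (ih (by omega) hj') (hX _ (hK.mem b) _ hj N hN)

lemma GP_le_perpCoresolved (hX : X ≤ leftPerp Y) : GP X Y ≤ PerpCoresolved X Y := by
  rintro M ⟨K, hK, ⟨e⟩⟩
  have hS : (fun N => ∃ n : ℤ, N = image (K.d n (n + 1))) ≤ PerpCoresolved X Y := by
    refine le_perpCoresolved ?_ ?_
    · rintro _ ⟨n, rfl⟩
      exact hK.leftPerp_image hX rfl
    · rintro _ ⟨n, rfl⟩
      exact ⟨_, _, SES.of_shortExact (hK.shortExact rfl rfl), hK.mem _, n + 1, rfl⟩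
  exact (hS _ ⟨-1, rfl⟩).of_iso e.symm

/-- Kernels of epimorphisms from `X` onto coresolved objects are again coresolved, so the cosyzygies
continue to the left by syzygies. All the pieces lie in ⊥Y, which makes the spliced complex `Hom(-,
N)`-acyclic for `N` in `Y`. -/
lemma perpCoresolved_le_GP (hX : X ≤ leftPerp Y) (hepi : IsEpic X) :
    PerpCoresolved X Y ≤ GP X Y := by
  intro M hM
  have next : ∀ N : Subtype (PerpCoresolved X Y), ∃ N' : Subtype (PerpCoresolved X Y),
      ∃ A : C, SES N.1 A N'.1 ∧ X A := fun N => by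
    obtain ⟨A, N', h, hA, hN'⟩ := N.2.exists_ses
    exact ⟨⟨N', hN'⟩, A, h, hA⟩
  have prev : ∀ N : Subtype (PerpCoresolved X Y), ∃ N' : Subtype (PerpCoresolved X Y),
      ∃ A : C, SES N'.1 A N.1 ∧ X A := fun N => by
    obtain ⟨A, p, hA, hp⟩ := hepi N.1
    have h : SES (kernel p) A N.1 :=
      SES.of_shortExact (ShortComplex.ShortExact.mk' (ShortComplex.exact_kernel p)
        inferInstance hp)
    exact ⟨⟨kernel p, PerpCoresolved.of_ses h
      (leftPerp_left h (hX A hA) (perpCoresolved_le_leftPerp _ N.2)) hA N.2⟩, A, h, hA⟩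
  choose s hs using next
  choose r hr using prev
  -- `Int.negSucc n` is `-(n + 1)`, hence `n + 1` syzygy steps; index `0` is `M`.
  let Z : ℤ → Subtype (PerpCoresolved X Y) := fun n => match n with
    | Int.ofNat n => s^[n] ⟨M, hM⟩
    | Int.negSucc n => r^[n + 1] ⟨M, hM⟩
  have hZ : ∀ n : ℤ, ∃ (A : C) (f : (Z n).1 ⟶ A) (g : A ⟶ (Z (n + 1)).1) (w : f ≫ g = 0),
      (ShortComplex.mk f g w).ShortExact ∧ X A := fun n => by
    have : ∃ A, SES (Z n).1 A (Z (n + 1)).1 ∧ X A := by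
      match n with
      | Int.ofNat n =>
        have : Z (Int.ofNat n + 1) = s (Z (Int.ofNat n)) := Function.iterate_succ_apply' s n _
        rw [this]
        exact hs _
      | Int.negSucc 0 => exact hr _
      | Int.negSucc (n + 1) =>
        have : Z (Int.negSucc (n + 1)) = r (Z (Int.negSucc n)) :=
          Function.iterate_succ_apply' r (n + 1) _
        rw [this]
        exact hr _
    obtain ⟨A, ⟨f, g, w, h⟩, hA⟩ := this
    exact ⟨A, f, g, w, h, hA⟩
  choose A f g w h hA using hZ
  refine ⟨splice f g w, ⟨hA, fun i => ?_, fun N hN n k hk => ?_⟩,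
    nonempty_splice_image_iso f g w h (k := -1) (n := 0) (by norm_num)⟩
  · obtain ⟨i, rfl⟩ : ∃ j, i = j + 1 := ⟨i - 1, by omega⟩
    exact splice_exactAt f g w h i
  · obtain ⟨m, rfl⟩ : ∃ m, n = m + 1 := ⟨n - 1, by omega⟩
    rw [add_sub_cancel_right, splice_d] at hk
    obtain ⟨t, ht⟩ := exists_factorization_of_shortExact f g w h k hk
      (perpCoresolved_le_leftPerp _ (Z (m + 1 + 1 + 1)).2 1 one_pos N hN)
    exact ⟨t, by rw [splice_d]; exact ht⟩

lemma WGP_eq_perpCoresolved : WGP X Y = PerpCoresolved X Y :=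
  le_antisymm WGP_le_perpCoresolved perpCoresolved_le_WGP

lemma GP_eq_perpCoresolved (hX : X ≤ leftPerp Y) (hepi : IsEpic X) :
    GP X Y = PerpCoresolved X Y :=
  le_antisymm (GP_le_perpCoresolved hX) (perpCoresolved_le_GP hX hepi)

end GorensteinProjective

/-! ### Comparison of the finitistic dimensions -/

section FinitisticDimensions

variable {C : Type u} [Category.{v} C] [Abelian C] {X Y : ObjectProperty C}

lemma GPAdmissible.le_leftPerp (h : GPAdmissible X Y) : X ≤ leftPerp Y :=
  le_leftPerp_of_relPdClass_eq_zero h.relPd_eq_zero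

/-- The class depends on `X` only through `X ⊓ Y`, although ω itself need not be epic. -/
lemma GPAdmissible.GP_eq_perpCoresolved_inf (h : GPAdmissible X Y) :
    GP X Y = PerpCoresolved (X ⊓ Y) Y := by
  rw [GP_eq_perpCoresolved h.le_leftPerp h.epic,
    perpCoresolved_eq_of_isRelCogenerator h.cogenerator h.le_leftPerp h.extensions]

lemma GPAdmissible.FGPD_eq_WFGPD (h : GPAdmissible X Y) : FGPD X Y = WFGPD (X ⊓ Y) Y := by
  rw [FGPD, WFGPD, h.GP_eq_perpCoresolved_inf, WGP_eq_perpCoresolved]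

lemma GPAdmissible.FGPD_eq_FPD (h : GPAdmissible X Y) (hproj : X ⊓ Y = isProjective C) :
    FGPD X Y = FPD C := by
  have hPX : isProjective C ≤ X := hproj ▸ inf_le_left
  have hPY : isProjective C ≤ Y := hproj ▸ inf_le_right
  have hG := h.GP_eq_perpCoresolved_inf
  rw [hproj] at hG
  rw [FPD_eq_resdimClass, FGPD, hG]
  -- Projectives lie in `X`, whose objects are coresolved by the cogenerator ω = Proj; this gives
  -- the inclusion of Proj in G.
  refine resdimClass_finRes_eq (perpCoresolved_le_leftPerp.trans (leftPerp_anti hPY))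
    (hPX.trans (hproj ▸ h.cogenerator.le_perpCoresolved h.le_leftPerp))
    (PerpCoresolved.of_extension hPY fun {A B} hA hB => ?_) (fun A hA => hA.exists_ses)
    fun {A B D} hS hB hD => PerpCoresolved.of_ses hS (leftPerp_left hS
      (isProjective_le_leftPerp Y B hB) (perpCoresolved_le_leftPerp D hD)) hB hD
  have : Projective A := hA
  have : Projective B := hB
  exact inferInstanceAs (Projective (A ⊞ B))

/-- If `X ∩ Y` is the class of projective objects, then the objects of `X` of finite projective
dimension are projective. -/
lemma GPAdmissible.eq_isProjective (h : GPAdmissible X Y) (hproj : X ⊓ Y = isProjective C)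
    (hfin : X ≤ finRes (isProjective C)) : X = isProjective C := by
  refine le_antisymm (fun M hM => ?_) (hproj ▸ inf_le_left)
  obtain ⟨m, hm⟩ := hfin M hM
  exact projective_of_hasRes hm fun j hj N hN =>
    h.le_leftPerp M hM j hj N ((hproj ▸ inf_le_right : isProjective C ≤ Y) N hN)

end FinitisticDimensions

end RelGor

theorem theorem4p23 {C : Type u} [Category.{v} C] [Abelian C] (X Y : ObjectProperty C)
    (hXY : RelGor.GPAdmissible X Y) (hproj : X ⊓ Y = isProjective C) :
    (RelGor.LeftThick X → X ≤ RelGor.finRes (isProjective C) →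
      (RelGor.FGPD X Y = RelGor.resdimClass X (RelGor.finRes X) ∧
        RelGor.resdimClass X (RelGor.finRes X) =
          RelGor.resdimClass X (RelGor.finRes (isProjective C)) ∧
        RelGor.resdimClass X (RelGor.finRes (isProjective C)) = RelGor.FPD C) ∧
      (EnoughProjectives C →
        RelGor.FGPD (isProjective C) Y = RelGor.FGPD X Y)) ∧
    (RelGor.FGPD X Y = RelGor.FPD C ∧
      RelGor.FPD C = RelGor.WFGPD (X ⊓ Y) Y ∧
      RelGor.WFGPD (X ⊓ Y) Y = RelGor.relPdClass (X ⊓ Y) (RelGor.finRes (X ⊓ Y)) ∧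
      RelGor.relPdClass (X ⊓ Y) (RelGor.finRes (X ⊓ Y)) =
        RelGor.relPdClass (RelGor.finRes (X ⊓ Y)) (RelGor.finRes (X ⊓ Y))) := by
  have hF := hXY.FGPD_eq_FPD hproj
  have hW := hXY.FGPD_eq_WFGPD
  have hω := RelGor.relPdClass_finRes_isProjective (le_refl (isProjective C))
  have hω' := RelGor.relPdClass_finRes_isProjective (RelGor.le_finRes (isProjective C))
  refine ⟨fun _ hfin => ?_, hF, hF.symm.trans hW, ?_, ?_⟩
  -- Once `X` is the class of projectives, (b) is trivial and (a) reduces to `FGPD_eq_FPD` and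
  -- `FPD_eq_resdimClass`.
  · have hX := hXY.eq_isProjective hproj hfin
    refine ⟨⟨?_, by rw [hX], by rw [hX, RelGor.FPD_eq_resdimClass]⟩, fun _ => by rw [hX]⟩
    rw [hF, RelGor.FPD_eq_resdimClass, hX]
  · rw [← hW, hF, RelGor.FPD_eq_resdimClass, hproj, hω]
  · rw [hproj, hω, hω']
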